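/- **Lower bound for cheap arms in bandits with cost subsidy.** Let $a_1,\dots,a_K$ be arms with known real costs $c_1,\dots,c_K$, let $\alpha\in[0,1)$, and let $\mathcal M$ be a family of probability distributions on $\mathbb R$ with finite means. An instance over $\mathcal M$ is a tuple $\nu=(\nu_1,\dots,\nu_K)\in\mathcal M^K$ of reward distributions; $\mu_i$ is the mean of $\nu_i$ and $\mu^*=\max_i\mu_i$. Arm $a_i$ is feasible if $\mu_i\ge(1-\alpha)\mu^*$, and an optimal arm $a^*$ is a feasible arm of least cost. A policy (possibly randomized, possibly depending on the horizon $T$) chooses in each round an arm on the basis of the arms pulled and the rewards observed so far; the reward is then drawn from the distribution of the chosen arm. Let $n_i(T)$ be the number of pulls of $a_i$ in $T$ rounds. The policy is consistent for $\mathcal M$ if, for every instance over $\mathcal M$ that has a feasible arm, every arm $a_i$ that is not optimal, and every $\gamma\in(0,1]$, $\mathbb E[n_i(T)]=o(T^\gamma)$ as $T\to\infty$. For $\rho\in\mathcal M$ and $x\in\mathbb R$ put $$D_{\inf}(\rho,x)=\inf\{\mathrm{KL}(\rho,\rho') : \rho'\in\mathcal M,\ \mathbb E[\rho']>x\}\in[0,\infty],\qquad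 \inf\emptyset=\infty .$$ 1. If a policy is consistent for $\mathcal M$, then for every instance $\nu$ over $\mathcal M$ with an optimal arm $a^*$ and every cheap arm $a_k$, that is, $c_k<c_{a^*}$, $$\liminf_{T\to\infty}\frac{\mathbb E_\nu[n_k(T)]}{\log T}\ \ge\ \frac{1}{D_{\inf}(\nu_k,(1-\alpha)\mu^*)}$$ in $[0,\infty]$, with $1/\infty=0$ and $1/0=\infty$. 2. If $\mathcal M$ is the family of all Gaussian distributions with variance $1$, then for every instance $\nu$ over $\mathcal M$ with an optimal arm $a^*$ and every cheap arm $a_k$, with $\Delta_{Q,k}=(1-\alpha)\mu^*-\mu_k$, $$\frac{1}{D_{\inf}(\nu_k,(1-\alpha)\mu^*)}=\frac{2}{\Delta_{Q,k}^2},$$ so that for every policy consistent for $\mathcal M$ $$\liminf_{T\to\infty}\frac{\mathbb E_\nu[n_k(T)]}{\log T}\ \ge\ \frac{2}{\Delta_{Q,k}^2}.$$ -/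

import Mathlib

open MeasureTheory ProbabilityTheory Filter Asymptotics
open scoped ENNReal

namespace CostSubsidyBandit

/-- A history of `t` rounds: the arm pulled and the reward observed in each round. -/
abbrev History (K t : ℕ) : Type := Fin t → Fin K × ℝ

/-- A (possibly randomized) policy: given the history of the first `t` rounds, the law of the arm
pulled in the next round. A deterministic policy is the case of Dirac masses. -/
structure Policy (K : ℕ) where
  select : ∀ t : ℕ, Kernel (History K t) (Fin K)
  markov : ∀ t : ℕ, IsMarkovKernel (select t)

/-- A bandit instance: a reward distribution for every arm. -/
abbrev Instance (K : ℕ) : Type := Fin K → ProbabilityMeasure ℝ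

/-- The mean of a reward distribution. -/
noncomputable def mean (ρ : ProbabilityMeasure ℝ) : ℝ := ∫ x, x ∂(ρ : Measure ℝ)

/-- The law of the reward, given the arm that is pulled. -/
noncomputable def rewardKernel {K : ℕ} (ν : Instance K) : Kernel (Fin K) ℝ :=
  Kernel.ofFunOfCountable fun i => (ν i : Measure ℝ)

/-- One round: an arm is drawn from the policy given the past, then a reward from that arm's
distribution. -/
noncomputable def roundKernel {K : ℕ} (π : Policy K) (ν : Instance K) (t : ℕ) :
    Kernel (History K t) (Fin K × ℝ) :=
  π.select t ⊗ₖ Kernel.prodMkLeft (History K t) (rewardKernel ν)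

/-- The law of the history of the first `t` rounds when `π` plays on `ν`. -/
noncomputable def law {K : ℕ} (π : Policy K) (ν : Instance K) : ∀ t : ℕ, Measure (History K t)
  | 0 => Measure.dirac Fin.elim0
  | t + 1 => (law π ν t ⊗ₘ roundKernel π ν t).map
      fun p => (Fin.snoc p.1 p.2 : History K (t + 1))

/-- The number `n_k(T)` of pulls of arm `k` in a history of length `T`. -/
def pulls {K T : ℕ} (k : Fin K) (h : History K T) : ℕ :=
  (Finset.univ.filter fun t => (h t).1 = k).card

/-- The expected number of pulls of arm `k` in the first `T` rounds when `π` plays on `ν`. -/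
noncomputable def expectedPulls {K : ℕ} (π : Policy K) (ν : Instance K) (k : Fin K) (T : ℕ) : ℝ :=
  ∫ h, (pulls k h : ℝ) ∂(law π ν T)

/-- The best mean `μ*` of an instance. -/
noncomputable def bestMean {K : ℕ} (ν : Instance K) : ℝ := ⨆ i, mean (ν i)

/-- The feasibility threshold `(1 - α) μ*`. -/
noncomputable def threshold {K : ℕ} (α : ℝ) (ν : Instance K) : ℝ := (1 - α) * bestMean ν

/-- Arm `i` is feasible: its mean reaches the threshold. -/
def IsFeasible {K : ℕ} (α : ℝ) (ν : Instance K) (i : Fin K) : Prop := threshold α ν ≤ mean (ν i)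

/-- Arm `a` is optimal: it has the least cost among the feasible arms. -/
def IsOptimalArm {K : ℕ} (c : Fin K → ℝ) (α : ℝ) (ν : Instance K) (a : Fin K) : Prop :=
  IsFeasible α ν a ∧ ∀ j, IsFeasible α ν j → c a ≤ c j

/-- The policies `π T`, one for each horizon `T` (a policy that ignores the horizon is a constant
`π`), are consistent for the family `M` of reward distributions: on every instance over `M` that
has an optimal arm, every arm that is not optimal is pulled `o(T ^ γ)` times in expectation, for
all `0 < γ ≤ 1`. -/
def IsConsistent {K : ℕ} (M : Set (ProbabilityMeasure ℝ)) (c : Fin K → ℝ) (α : ℝ)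
    (π : ℕ → Policy K) : Prop :=
  ∀ ν : Instance K, (∀ i, ν i ∈ M) → (∃ a, IsOptimalArm c α ν a) →
    ∀ i, ¬ IsOptimalArm c α ν i → ∀ γ : ℝ, 0 < γ → γ ≤ 1 →
      (fun T : ℕ => expectedPulls (π T) ν i T) =o[atTop] fun T : ℕ => (T : ℝ) ^ γ

/-- `D_inf(ρ, x)`: the infimum of `KL(ρ, ρ')` over the `ρ'` in `M` with mean larger than `x`
(`∞` if there are none). -/
noncomputable def Dinf (M : Set (ProbabilityMeasure ℝ)) (ρ : ProbabilityMeasure ℝ) (x : ℝ) :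
    ℝ≥0∞ :=
  ⨅ ρ' ∈ {ρ' : ProbabilityMeasure ℝ | ρ' ∈ M ∧ x < mean ρ'},
    InformationTheory.klDiv (ρ : Measure ℝ) (ρ' : Measure ℝ)

/-- The family of all Gaussian distributions with unit variance. -/
def unitGaussians : Set (ProbabilityMeasure ℝ) :=
  {ρ | ∃ m : ℝ, (ρ : Measure ℝ) = gaussianReal m 1}

/-- `liminf E[n_k(T)] / log T` as `T → ∞`, in `[0, ∞]`. -/
noncomputable def liminfRate {K : ℕ} (π : ℕ → Policy K) (ν : Instance K) (k : Fin K) : ℝ≥0∞ :=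
  liminf (fun T : ℕ => ENNReal.ofReal (expectedPulls (π T) ν k T / Real.log T)) atTop

end CostSubsidyBandit

/-! ### Inequalities for the Kullback–Leibler divergence -/

namespace InformationTheory

/-! The proof is a change of measure. Replace the law of the cheap arm `k` by some `ρ'` in `M` with
mean above the threshold: `k` becomes the only optimal arm (`isOptimalArm_update_iff`). By
consistency a policy then spends only `o(T ^ γ)` rounds off `k`, whereas on `ν` it spends only
`o(T)` rounds on `k`. Such different behaviour needs distinguishable histories. Their divergence is
at most `E[n_k(T)] * KL(ν_k, ρ')` (`klDiv_law_update_le`), and a Donsker–Varadhan bound for the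
fraction of rounds off `k` shows that it is at least about `(1 - γ) log T`
(`eventually_le_of_change_of_measure`). Let `γ → 0` and optimize over `ρ'`. For Gaussians the
divergence is explicit, and the infimum is its value at the threshold. -/

/-- Young's inequality for the convex function `klFun`. -/
lemma mul_sub_exp_le_klFun {x : ℝ} (hx : 0 ≤ x) (y : ℝ) :
    x * y - (Real.exp y - 1) ≤ klFun x := by
  rcases hx.eq_or_lt with rfl | hx
  · simp [klFun, (Real.exp_pos y).le]
  · have h := Real.log_le_sub_one_of_pos (div_pos (Real.exp_pos y) hx)
    rw [Real.log_div (Real.exp_pos y).ne' hx.ne', Real.log_exp] at h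
    have h2 := mul_le_mul_of_nonneg_left h hx.le
    have h3 : x * (Real.exp y / x - 1) = Real.exp y - x := by field_simp
    rw [h3] at h2
    simp only [klFun]
    linarith

/-- The chord of `exp` between `0` and `l` lies above the graph; this makes the exponential moment
linear in `Z`. -/
lemma exp_mul_sub_one_le {z : ℝ} (hz0 : 0 ≤ z) (hz1 : z ≤ 1) (l : ℝ) :
    Real.exp (l * z) - 1 ≤ z * (Real.exp l - 1) := by
  have h := convexOn_exp.2 (Set.mem_univ 0) (Set.mem_univ l) (sub_nonneg.2 hz1) hz0 (by ring)
  simp only [smul_eq_mul, mul_zero, zero_add, Real.exp_zero] at h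
  rw [mul_comm l z]
  linarith

/-- A Donsker–Varadhan type lower bound on the Kullback–Leibler divergence by the expectations of
a random variable with values in `[0, 1]`. -/
lemma integral_sub_le_toReal_klDiv {Ω : Type*} [MeasurableSpace Ω] (P Q : Measure Ω)
    [IsProbabilityMeasure P] [IsProbabilityMeasure Q] (hPQ : klDiv P Q ≠ ∞) {Z : Ω → ℝ}
    (hZ : Measurable Z) (hZ0 : ∀ ω, 0 ≤ Z ω) (hZ1 : ∀ ω, Z ω ≤ 1) (l : ℝ) :
    l * ∫ ω, Z ω ∂P - (Real.exp l - 1) * ∫ ω, Z ω ∂Q ≤ (klDiv P Q).toReal := by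
  obtain ⟨hac, hint⟩ := klDiv_ne_top_iff.1 hPQ
  have hZi : ∀ (R : Measure Ω) [IsProbabilityMeasure R], Integrable Z R := fun R _ =>
    Integrable.of_bound hZ.aestronglyMeasurable 1
      (.of_forall fun ω => by rw [Real.norm_of_nonneg (hZ0 ω)]; exact hZ1 ω)
  have h1 : Integrable (fun ω => (P.rnDeriv Q ω).toReal * (l * Z ω)) Q :=
    (integrable_toReal_rnDeriv_mul_iff hac).2 ((hZi P).const_mul l)
  have h2 : ∫ ω, (P.rnDeriv Q ω).toReal * (l * Z ω) ∂Q = l * ∫ ω, Z ω ∂P := by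
    rw [← integral_const_mul]
    exact integral_rnDeriv_smul hac
  rw [toReal_klDiv_eq_integral_klFun hac]
  rw [← h2, ← integral_const_mul, ← integral_sub h1 ((hZi Q).const_mul _)]
  have := integral_mono (h1.sub ((hZi Q).const_mul (Real.exp l - 1)))
    ((integrable_klFun_rnDeriv_iff hac).2 hint) (fun ω => by
      have a := mul_sub_exp_le_klFun (x := (P.rnDeriv Q ω).toReal) ENNReal.toReal_nonneg (l * Z ω)
      have b := exp_mul_sub_one_le (hZ0 ω) (hZ1 ω) l
      simp only [Pi.sub_apply]
      linarith)
  exact this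

/-- The divergence of two composition-products whose kernels differ only on a set, where they are
constant. -/
lemma klDiv_compProd_of_eq_off {X Y : Type*} [MeasurableSpace X] [MeasurableSpace Y]
    (Q : Measure X) [IsFiniteMeasure Q] (κ η : Kernel X Y) [IsMarkovKernel κ] [IsMarkovKernel η]
    {ρ ρ' : Measure Y} [IsFiniteMeasure ρ] [IsFiniteMeasure ρ'] (hρ : ρ ≪ ρ')
    {B : Set X} (hB : MeasurableSet B) (hκ : ∀ x ∈ B, κ x = ρ) (hη : ∀ x ∈ B, η x = ρ')
    (hκη : ∀ x ∉ B, κ x = η x) :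
    klDiv (Q ⊗ₘ κ) (Q ⊗ₘ η) = Q B * klDiv ρ ρ' := by
  classical
  -- Candidate density: that of `ρ` over `B`, and `1` elsewhere, where `klFun` vanishes.
  set f : X × Y → ℝ≥0∞ := fun p => if p.1 ∈ B then ρ.rnDeriv ρ' p.2 else 1 with hf
  have hfm : Measurable f :=
    Measurable.ite (measurable_fst hB) ((Measure.measurable_rnDeriv _ _).comp measurable_snd)
      measurable_const
  have hd : (Q ⊗ₘ η).withDensity f = Q ⊗ₘ κ := by
    ext s hs
    rw [withDensity_apply _ hs, ← lintegral_indicator hs,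
      Measure.lintegral_compProd (hfm.indicator hs), Measure.compProd_apply hs]
    refine lintegral_congr fun x => ?_
    have hsx : MeasurableSet (Prod.mk x ⁻¹' s) := measurable_prodMk_left hs
    have : ∀ y, s.indicator f (x, y) = (Prod.mk x ⁻¹' s).indicator (fun y => f (x, y)) y :=
      fun y => rfl
    simp_rw [this]
    rw [lintegral_indicator hsx]
    by_cases hx : x ∈ B
    · simp only [hf, hx, if_true]
      rw [hκ x hx, hη x hx, Measure.setLIntegral_rnDeriv hρ]
    · simp only [hf, hx, if_false]
      rw [hκη x hx, setLIntegral_one]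
  have hac : Q ⊗ₘ κ ≪ Q ⊗ₘ η := hd ▸ withDensity_absolutelyContinuous _ _
  have hr : (Q ⊗ₘ κ).rnDeriv (Q ⊗ₘ η) =ᵐ[Q ⊗ₘ η] f := by
    rw [← hd]; exact Measure.rnDeriv_withDensity _ hfm
  rw [klDiv_eq_lintegral_klFun_of_ac hac]
  have h1 : ∫⁻ p, ENNReal.ofReal (klFun ((Q ⊗ₘ κ).rnDeriv (Q ⊗ₘ η) p).toReal) ∂(Q ⊗ₘ η)
      = ∫⁻ p, ENNReal.ofReal (klFun (f p).toReal) ∂(Q ⊗ₘ η) :=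
    lintegral_congr_ae (hr.mono fun p hp => by simp only [hp])
  rw [h1, Measure.lintegral_compProd (by fun_prop)]
  have h2 : ∀ x, ∫⁻ y, ENNReal.ofReal (klFun (f (x, y)).toReal) ∂(η x)
      = B.indicator (fun _ => klDiv ρ ρ') x := by
    intro x
    by_cases hx : x ∈ B
    · simp only [hf, hx, if_true, Set.indicator_of_mem]
      rw [hη x hx, klDiv_eq_lintegral_klFun_of_ac hρ]
    · simp [hf, hx, klFun_one]
  simp_rw [h2]
  rw [lintegral_indicator hB, setLIntegral_const, mul_comm]

end InformationTheory

/-! ### Laws of histories and the divergence decomposition -/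

namespace CostSubsidyBandit

instance isMarkovKernel_rewardKernel {K : ℕ} (ν : Instance K) :
    IsMarkovKernel (rewardKernel ν) :=
  ⟨fun i => by
    simp only [rewardKernel, Kernel.ofFunOfCountable]
    exact (ν i).2⟩

lemma rewardKernel_apply {K : ℕ} (ν : Instance K) (i : Fin K) :
    rewardKernel ν i = (ν i : Measure ℝ) := rfl

instance isMarkovKernel_select {K : ℕ} (π : Policy K) (t : ℕ) : IsMarkovKernel (π.select t) :=
  π.markov t

instance isMarkovKernel_roundKernel {K : ℕ} (π : Policy K) (ν : Instance K) (t : ℕ) :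
    IsMarkovKernel (roundKernel π ν t) := by
  unfold roundKernel
  infer_instance

lemma measurable_snoc {K t : ℕ} :
    Measurable fun p : History K t × (Fin K × ℝ) => (Fin.snoc p.1 p.2 : History K (t + 1)) := by
  refine measurable_pi_iff.2 fun i => ?_
  induction i using Fin.lastCases with
  | last => simpa using measurable_snd
  | cast i =>
    simp only [Fin.snoc_castSucc]
    exact (measurable_pi_apply i).comp measurable_fst

instance isProbabilityMeasure_law {K : ℕ} (π : Policy K) (ν : Instance K) (t : ℕ) :
    IsProbabilityMeasure (law π ν t) := by
  induction t with
  | zero => unfold law; infer_instance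
  | succ t ih => exact Measure.isProbabilityMeasure_map measurable_snoc.aemeasurable

lemma pulls_snoc {K t : ℕ} (k : Fin K) (h : History K t) (p : Fin K × ℝ) :
    pulls k (Fin.snoc h p : History K (t + 1)) = pulls k h + if p.1 = k then 1 else 0 := by
  simp only [pulls, Finset.card_filter, Fin.sum_univ_castSucc, Fin.snoc_castSucc, Fin.snoc_last]

lemma pulls_le {K t : ℕ} (k : Fin K) (h : History K t) : pulls k h ≤ t :=
  (Finset.card_filter_le _ _).trans (by simp)

lemma sum_pulls {K t : ℕ} (h : History K t) : ∑ k, pulls k h = t := by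
  have := Finset.card_eq_sum_card_fiberwise (f := fun t => (h t).1) (s := Finset.univ)
    (t := Finset.univ) (by simp)
  simpa [pulls] using this.symm

lemma measurable_pulls {K t : ℕ} (k : Fin K) : Measurable (pulls k : History K t → ℕ) := by
  unfold pulls
  simp only [Finset.card_filter]
  refine Finset.measurable_sum _ fun i _ => ?_
  exact Measurable.ite (((measurable_pi_apply i).fst) (measurableSet_singleton k))
    measurable_const measurable_const

lemma measurable_pulls_real {K t : ℕ} (k : Fin K) :
    Measurable fun h : History K t => (pulls k h : ℝ) :=
  (measurable_from_top (f := fun n : ℕ => (n : ℝ))).comp (measurable_pulls k)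

lemma measurable_pulls_ennreal {K t : ℕ} (k : Fin K) :
    Measurable fun h : History K t => (pulls k h : ℝ≥0∞) :=
  (measurable_from_top (f := fun n : ℕ => (n : ℝ≥0∞))).comp (measurable_pulls k)

lemma integrable_pulls {K : ℕ} (π : Policy K) (ν : Instance K) (k : Fin K) (T : ℕ) :
    Integrable (fun h => (pulls k h : ℝ)) (law π ν T) :=
  Integrable.of_bound (measurable_pulls_real k).aestronglyMeasurable T
    (.of_forall fun h => by simpa using pulls_le k h)

lemma expectedPulls_nonneg {K : ℕ} (π : Policy K) (ν : Instance K) (k : Fin K) (T : ℕ) :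
    0 ≤ expectedPulls π ν k T :=
  integral_nonneg fun _ => Nat.cast_nonneg _

lemma sum_expectedPulls {K : ℕ} (π : Policy K) (ν : Instance K) (T : ℕ) :
    ∑ k, expectedPulls π ν k T = T := by
  simp only [expectedPulls]
  rw [← integral_finsetSum _ fun k _ => integrable_pulls π ν k T]
  simp_rw [← Nat.cast_sum, sum_pulls]
  simp

lemma ofReal_expectedPulls {K : ℕ} (π : Policy K) (ν : Instance K) (k : Fin K) (T : ℕ) :
    ENNReal.ofReal (expectedPulls π ν k T) = ∫⁻ h, (pulls k h : ℝ≥0∞) ∂(law π ν T) := by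
  rw [expectedPulls, ofReal_integral_eq_lintegral_ofReal (integrable_pulls π ν k T)
    (.of_forall fun _ => Nat.cast_nonneg _)]
  simp

/-- With the drawn arm grouped with the past, the reward kernels of two instances that differ in arm
`k` agree off `{x | x.2 = k}`. -/
lemma compProd_roundKernel {K : ℕ} (π : Policy K) (ν : Instance K) (t : ℕ)
    (P : Measure (History K t)) :
    P ⊗ₘ roundKernel π ν t =
      ((P ⊗ₘ π.select t) ⊗ₘ Kernel.prodMkLeft (History K t) (rewardKernel ν)).map
        MeasurableEquiv.prodAssoc :=
  Measure.compProd_assoc'.symm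

lemma measurableSet_arm_eq {X : Type*} [MeasurableSpace X] {K : ℕ} (k : Fin K) :
    MeasurableSet {x : X × Fin K | x.2 = k} :=
  measurable_snd (measurableSet_singleton k)

lemma lintegral_pulls_succ {K : ℕ} (π : Policy K) (ν : Instance K) (k : Fin K) (t : ℕ) :
    ∫⁻ h, (pulls k h : ℝ≥0∞) ∂(law π ν (t + 1)) =
      ∫⁻ h, (pulls k h : ℝ≥0∞) ∂(law π ν t) + (law π ν t ⊗ₘ π.select t) {x | x.2 = k} := by
  rw [law, lintegral_map (measurable_pulls_ennreal k) measurable_snoc]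
  simp only [pulls_snoc, Nat.cast_add]
  rw [lintegral_add_left (f := fun p : History K t × (Fin K × ℝ) => (pulls k p.1 : ℝ≥0∞))
    ((measurable_pulls_ennreal k).comp measurable_fst)]
  congr 1
  · rw [← lintegral_map (f := fun h : History K t => (pulls k h : ℝ≥0∞))
      (measurable_pulls_ennreal k) measurable_fst]
    congr 1
    exact Measure.fst_compProd _ _
  · have hS : MeasurableSet {p : History K t × (Fin K × ℝ) | p.2.1 = k} :=
      measurable_snd.fst (measurableSet_singleton k)
    have : ∀ p : History K t × (Fin K × ℝ), ((if p.2.1 = k then 1 else 0 : ℕ) : ℝ≥0∞) =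
        {p : History K t × (Fin K × ℝ) | p.2.1 = k}.indicator 1 p := fun p => by
      by_cases h : p.2.1 = k <;> simp [h]
    simp_rw [this]
    rw [lintegral_indicator_one hS, compProd_roundKernel,
      Measure.map_apply MeasurableEquiv.prodAssoc.measurable hS]
    conv_rhs => rw [← Measure.fst_compProd (law π ν t ⊗ₘ π.select t)
      (Kernel.prodMkLeft (History K t) (rewardKernel ν)),
      Measure.fst_apply (measurableSet_arm_eq k)]
    rfl

/-- The divergence decomposition, as an inequality: changing the reward distribution of a single
arm costs at most its divergence per expected pull. -/
lemma klDiv_law_update_le {K : ℕ} (π : Policy K) (ν : Instance K) (k : Fin K)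
    (ρ' : ProbabilityMeasure ℝ) (hρ : (ν k : Measure ℝ) ≪ (ρ' : Measure ℝ)) (T : ℕ) :
    InformationTheory.klDiv (law π ν T) (law π (Function.update ν k ρ') T) ≤
      ENNReal.ofReal (expectedPulls π ν k T) *
        InformationTheory.klDiv (ν k : Measure ℝ) (ρ' : Measure ℝ) := by
  rw [ofReal_expectedPulls]
  induction T with
  | zero => simp [law, InformationTheory.klDiv_self]
  | succ t ih =>
    rw [lintegral_pulls_succ, add_mul]
    refine (InformationTheory.klDiv_map_le _ _ measurable_snoc).trans ?_
    -- In the chain rule, both kernels of the conditional term are integrated against the history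
    -- law under `ν`; hence pulls are counted under `ν`.
    rw [InformationTheory.klDiv_compProd_eq_add]
    refine add_le_add ih ?_
    rw [compProd_roundKernel, compProd_roundKernel]
    refine (InformationTheory.klDiv_map_le _ _ MeasurableEquiv.prodAssoc.measurable).trans ?_
    refine (InformationTheory.klDiv_compProd_of_eq_off _ _ _ hρ (measurableSet_arm_eq k)
      ?_ ?_ ?_).le
    · rintro ⟨h, i⟩ rfl
      simp [Kernel.prodMkLeft_apply, rewardKernel_apply]
    · rintro ⟨h, i⟩ rfl
      simp [Kernel.prodMkLeft_apply, rewardKernel_apply]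
    · rintro ⟨h, i⟩ hi
      have : i ≠ k := hi
      simp [Kernel.prodMkLeft_apply, rewardKernel_apply, this]

end CostSubsidyBandit

/-! ### The altered instance and the asymptotic lower bound -/

namespace CostSubsidyBandit

lemma mean_le_bestMean {K : ℕ} (ν : Instance K) (i : Fin K) : mean (ν i) ≤ bestMean ν :=
  le_ciSup (f := fun i => mean (ν i)) (Set.finite_range _).bddAbove i

/-- Once the mean of an arm that is cheaper than the optimal one is raised above the feasibility
threshold, this arm is feasible, and strictly cheaper than all other feasible arms. -/
lemma isOptimalArm_update_iff {K : ℕ} {c : Fin K → ℝ} {α : ℝ} (hα0 : 0 ≤ α) (hα1 : α < 1)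
    {ν : Instance K} {a k : Fin K} (ha : IsOptimalArm c α ν a) (hk : c k < c a)
    {ρ' : ProbabilityMeasure ℝ} (hρ' : threshold α ν < mean ρ') (j : Fin K) :
    IsOptimalArm c α (Function.update ν k ρ') j ↔ j = k := by
  set ν' := Function.update ν k ρ' with hν'
  have hkk : ν' k = ρ' := Function.update_self ..
  have hne : ∀ i, i ≠ k → ν' i = ν i := fun i hi => Function.update_of_ne hi ..
  have hkinf : mean (ν k) < threshold α ν := by
    by_contra h
    exact absurd (ha.2 k (not_lt.1 h)) (not_le.2 hk)
  -- Means may be negative. This sign, forced by a feasible arm, lets `ρ'` meet the new threshold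
  -- when it has the best mean itself.
  have hpos : 0 ≤ α * bestMean ν := by
    have h1 : threshold α ν ≤ mean (ν a) := ha.1
    have h2 := mean_le_bestMean ν a
    unfold threshold at h1
    linarith
  have : Nonempty (Fin K) := ⟨k⟩
  have hle : bestMean ν ≤ bestMean ν' := by
    refine ciSup_le fun i => ?_
    by_cases hi : i = k
    · have := mean_le_bestMean ν' k
      rw [hkk] at this
      rw [hi]
      linarith
    · rw [← hne i hi]
      exact mean_le_bestMean ν' i
  have hthr : threshold α ν ≤ threshold α ν' := mul_le_mul_of_nonneg_left hle (by linarith)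
  have hge : bestMean ν' ≤ max (bestMean ν) (mean ρ') := by
    refine ciSup_le fun i => ?_
    by_cases hi : i = k
    · rw [hi, hkk]
      exact le_max_right _ _
    · rw [hne i hi]
      exact (mean_le_bestMean ν i).trans (le_max_left _ _)
  have hfeas : IsFeasible α ν' k := by
    unfold IsFeasible
    rw [hkk]
    refine (mul_le_mul_of_nonneg_left hge (by linarith : (0 : ℝ) ≤ 1 - α)).trans ?_
    rcases le_total (bestMean ν) (mean ρ') with h | h
    · rw [max_eq_right h]
      have := mul_le_mul_of_nonneg_left h hα0
      linarith
    · rw [max_eq_left h]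
      exact hρ'.le
  have hcost : ∀ i, i ≠ k → IsFeasible α ν' i → c k < c i := fun i hi hf => by
    refine hk.trans_le (ha.2 i (hthr.trans ?_))
    rw [← hne i hi]
    exact hf
  constructor
  · intro h
    by_contra hj
    exact absurd (h.2 k hfeas) (not_le.2 (hcost j hj h.1))
  · rintro rfl
    refine ⟨hfeas, fun i hi => ?_⟩
    by_cases hij : i = j
    · rw [hij]
    · exact (hcost i hij hi).le

/-- The change-of-measure inequality for the expected number of pulls of an arm. -/
lemma expectedPulls_change_of_measure {K : ℕ} (π : Policy K) (ν : Instance K) (k : Fin K)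
    (ρ' : ProbabilityMeasure ℝ)
    (hD : InformationTheory.klDiv (ν k : Measure ℝ) (ρ' : Measure ℝ) ≠ ∞)
    {T : ℕ} (hT : 0 < T) (l : ℝ) :
    l * (1 - expectedPulls π ν k T / T) -
        (Real.exp l - 1) * (1 - expectedPulls π (Function.update ν k ρ') k T / T) ≤
      expectedPulls π ν k T *
        (InformationTheory.klDiv (ν k : Measure ℝ) (ρ' : Measure ℝ)).toReal := by
  have hle := klDiv_law_update_le π ν k ρ' (InformationTheory.klDiv_ne_top_iff.1 hD).1 T
  have hne := ENNReal.mul_ne_top (ENNReal.ofReal_ne_top (r := expectedPulls π ν k T)) hD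
  have hle' := ENNReal.toReal_mono hne hle
  rw [ENNReal.toReal_mul, ENNReal.toReal_ofReal (expectedPulls_nonneg π ν k T)] at hle'
  refine le_trans ?_ hle'
  have hT' : (0 : ℝ) < T := Nat.cast_pos.2 hT
  have hZ := InformationTheory.integral_sub_le_toReal_klDiv _ _ (ne_top_of_le_ne_top hne hle)
    (Z := fun h => 1 - (pulls k h : ℝ) / T)
    (measurable_const.sub ((measurable_pulls_real k).div_const _))
    (fun h => sub_nonneg.2 ((div_le_one hT').2 (Nat.cast_le.2 (pulls_le k h))))
    (fun h => sub_le_self _ (by positivity)) l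
  have hint : ∀ ν' : Instance K, ∫ h, (1 - (pulls k h : ℝ) / T) ∂(law π ν' T) =
      1 - expectedPulls π ν' k T / T := fun ν' => by
    rw [integral_sub (integrable_const _) ((integrable_pulls π ν' k T).div_const _),
      integral_div]
    simp [expectedPulls]
  rwa [hint, hint] at hZ

lemma eventually_le_of_change_of_measure {E E' : ℕ → ℝ} {D : ℝ}
    (h : ∀ T : ℕ, 0 < T → ∀ l : ℝ,
      l * (1 - E T / T) - (Real.exp l - 1) * (1 - E' T / T) ≤ E T * D)
    (hE' : ∀ T, E' T ≤ T) (hE : E =o[atTop] fun T : ℕ => (T : ℝ))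
    (hE'o : ∀ γ : ℝ, 0 < γ → γ ≤ 1 →
      (fun T : ℕ => (T : ℝ) - E' T) =o[atTop] fun T : ℕ => (T : ℝ) ^ γ)
    {r : ℝ} (hr : r < 1) :
    ∀ᶠ T : ℕ in atTop, r ≤ E T / Real.log T * D := by
  obtain ⟨γ, hγ0, hγ1, hγr⟩ : ∃ γ : ℝ, 0 < γ ∧ γ ≤ 1 ∧ r < 1 - γ := by
    refine ⟨min 1 ((1 - r) / 2), lt_min one_pos (by linarith), min_le_left _ _, ?_⟩
    have := min_le_right 1 ((1 - r) / 2)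
    linarith
  have h1 := hE.tendsto_div_nhds_zero
  have h2 := (hE'o γ hγ0 hγ1).tendsto_div_nhds_zero
  have hlog : Tendsto (fun T : ℕ => Real.log T) atTop atTop :=
    Real.tendsto_log_atTop.comp tendsto_natCast_atTop_atTop
  have h3 : Tendsto (fun T : ℕ => (1 - γ) * (1 - E T / T) - ((T - E' T) / (T : ℝ) ^ γ) / Real.log T)
      atTop (nhds ((1 - γ) * (1 - 0) - 0)) :=
    ((h1.const_sub 1).const_mul (1 - γ)).sub (h2.div_atTop hlog)
  rw [sub_zero, sub_zero, mul_one] at h3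
  filter_upwards [h3.eventually (lt_mem_nhds hγr), hlog.eventually_gt_atTop 0,
    eventually_gt_atTop 0] with T hT hl hT0
  have hT' : (0 : ℝ) < T := Nat.cast_pos.2 hT0
  -- This `l` turns the penalty `exp l * (1 - E' T / T)` into `(T - E' T) / T ^ γ`, which tends to
  -- `0`.
  have key := h T hT0 ((1 - γ) * Real.log T)
  have hexp : Real.exp ((1 - γ) * Real.log T) * (1 - E' T / T) = (T - E' T) / (T : ℝ) ^ γ := by
    rw [mul_comm, mul_comm (1 - γ), ← Real.rpow_def_of_pos hT', Real.rpow_sub hT', Real.rpow_one]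
    field_simp
  have hnn : 0 ≤ 1 - E' T / T := sub_nonneg.2 ((div_le_one hT').2 (hE' T))
  rw [sub_mul (Real.exp _), hexp, one_mul] at key
  have key2 : (1 - γ) * Real.log T * (1 - E T / T) - (T - E' T) / (T : ℝ) ^ γ ≤ E T * D := by
    linarith
  refine hT.le.trans ?_
  rw [div_mul_eq_mul_div, le_div_iff₀ hl, sub_mul, div_mul_cancel₀ _ hl.ne']
  linarith

theorem one_div_Dinf_le_liminfRate {K : ℕ} {c : Fin K → ℝ} {α : ℝ} (hα0 : 0 ≤ α) (hα1 : α < 1)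
    {π : ℕ → Policy K} {M : Set (ProbabilityMeasure ℝ)} (hcons : IsConsistent M c α π)
    {ν : Instance K} (hν : ∀ i, ν i ∈ M) {a : Fin K} (ha : IsOptimalArm c α ν a)
    {k : Fin K} (hk : c k < c a) :
    1 / Dinf M (ν k) (threshold α ν) ≤ liminfRate π ν k := by
  -- Inverting moves the infimum to the right, so each `ρ'` can be treated separately.
  rw [one_div, ENNReal.inv_le_iff_inv_le]
  refine le_iInf₂ fun ρ' hρ' => ?_
  rw [ENNReal.inv_le_iff_inv_le]
  set κ := InformationTheory.klDiv (ν k : Measure ℝ) (ρ' : Measure ℝ) with hκ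
  by_cases hD : κ = ∞
  · simp [hD]
  set ν' := Function.update ν k ρ' with hν'
  have hopt : ∀ j, IsOptimalArm c α ν' j ↔ j = k :=
    isOptimalArm_update_iff hα0 hα1 ha hk hρ'.2
  have hν'M : ∀ i, ν' i ∈ M := fun i => by
    by_cases hi : i = k
    · rw [hi, hν', Function.update_self]; exact hρ'.1
    · rw [hν', Function.update_of_ne hi]; exact hν i
  have hknot : ¬ IsOptimalArm c α ν k := fun h =>
    absurd (ha.2 k h.1) (not_le.2 hk)
  have hE : (fun T => expectedPulls (π T) ν k T) =o[atTop] fun T : ℕ => (T : ℝ) := by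
    simpa using hcons ν hν ⟨a, ha⟩ k hknot 1 one_pos le_rfl
  have hsum : ∀ T : ℕ, (T : ℝ) - expectedPulls (π T) ν' k T =
      ∑ j ∈ Finset.univ.erase k, expectedPulls (π T) ν' j T := fun T => by
    rw [← sum_expectedPulls (π T) ν' T, ← Finset.add_sum_erase _ _ (Finset.mem_univ k)]
    ring
  have hE'o : ∀ γ : ℝ, 0 < γ → γ ≤ 1 →
      (fun T : ℕ => (T : ℝ) - expectedPulls (π T) ν' k T) =o[atTop]
        fun T : ℕ => (T : ℝ) ^ γ := fun γ h0 h1 => by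
    simp_rw [hsum]
    exact IsLittleO.fun_sum fun j hj => hcons ν' hν'M ⟨k, (hopt k).2 rfl⟩ j
      (fun h => Finset.ne_of_mem_erase hj ((hopt j).1 h)) γ h0 h1
  have hE' : ∀ T : ℕ, expectedPulls (π T) ν' k T ≤ T := fun T => by
    have := Finset.sum_nonneg fun j (_ : j ∈ Finset.univ.erase k) =>
      expectedPulls_nonneg (π T) ν' j T
    rw [← hsum] at this
    linarith
  have main := fun r (hr : r < 1) => eventually_le_of_change_of_measure
    (fun T hT l => expectedPulls_change_of_measure (π T) ν k ρ' hD hT l) hE' hE hE'o (r := r) hr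
  rw [← hκ] at main
  -- Zero divergence would turn `main` into `1 / 2 ≤ 0`: consistency excludes it.
  have hD0 : 0 < κ.toReal := by
    refine lt_of_le_of_ne ENNReal.toReal_nonneg fun h => ?_
    obtain ⟨T, hT⟩ := (main (1 / 2) (by norm_num)).exists
    rw [← h, mul_zero] at hT
    norm_num at hT
  refine le_of_forall_lt_imp_le_of_dense fun b hb => ?_
  have hbt : b ≠ ∞ := hb.ne_top
  have hb' : b.toReal * κ.toReal < 1 := by
    have h1 := (ENNReal.toReal_lt_toReal hbt
      (ENNReal.inv_ne_top.2 fun h => by simp [h] at hD0)).2 hb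
    rw [ENNReal.toReal_inv] at h1
    calc b.toReal * κ.toReal < κ.toReal⁻¹ * κ.toReal := mul_lt_mul_of_pos_right h1 hD0
      _ = 1 := inv_mul_cancel₀ hD0.ne'
  refine le_liminf_of_le (by isBoundedDefault) ?_
  filter_upwards [main _ hb'] with T hT
  rw [← ENNReal.ofReal_toReal hbt]
  exact ENNReal.ofReal_le_ofReal (le_of_mul_le_mul_right hT hD0)

lemma mean_eq_of_eq_gaussianReal {ρ : ProbabilityMeasure ℝ} {m : ℝ}
    (h : (ρ : Measure ℝ) = gaussianReal m 1) : mean ρ = m := by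
  rw [mean, h, integral_id_gaussianReal]

end CostSubsidyBandit

/-! ### Gaussian distributions of unit variance -/

namespace ProbabilityTheory

lemma gaussianReal_eq_withDensity (m₁ m₂ : ℝ) :
    gaussianReal m₁ 1 = (gaussianReal m₂ 1).withDensity
      fun x => ENNReal.ofReal (Real.exp ((m₁ - m₂) * x - (m₁ ^ 2 - m₂ ^ 2) / 2)) := by
  rw [gaussianReal_of_var_ne_zero _ one_ne_zero, gaussianReal_of_var_ne_zero _ one_ne_zero,
    ← withDensity_mul _ (measurable_gaussianPDF _ _) (by fun_prop)]
  congr 1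
  ext x
  simp only [gaussianPDF, Pi.mul_apply, gaussianPDFReal]
  rw [← ENNReal.ofReal_mul (by positivity), mul_assoc (√(2 * Real.pi * _))⁻¹, ← Real.exp_add]
  congr 3
  simp
  ring

/-- The Kullback–Leibler divergence of two Gaussian distributions of unit variance. -/
lemma klDiv_gaussianReal_one (m₁ m₂ : ℝ) :
    InformationTheory.klDiv (gaussianReal m₁ 1) (gaussianReal m₂ 1) =
      ENNReal.ofReal ((m₁ - m₂) ^ 2 / 2) := by
  have hac : gaussianReal m₁ 1 ≪ gaussianReal m₂ 1 :=
    gaussianReal_eq_withDensity m₁ m₂ ▸ withDensity_absolutelyContinuous _ _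
  have hr : (gaussianReal m₁ 1).rnDeriv (gaussianReal m₂ 1) =ᵐ[gaussianReal m₂ 1]
      fun x => ENNReal.ofReal (Real.exp ((m₁ - m₂) * x - (m₁ ^ 2 - m₂ ^ 2) / 2)) := by
    conv_lhs => rw [gaussianReal_eq_withDensity m₁ m₂]
    exact Measure.rnDeriv_withDensity _ (by fun_prop)
  have hllr : llr (gaussianReal m₁ 1) (gaussianReal m₂ 1) =ᵐ[gaussianReal m₁ 1]
      fun x => (m₁ - m₂) * x - (m₁ ^ 2 - m₂ ^ 2) / 2 := by
    filter_upwards [hac.ae_le hr] with x hx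
    rw [llr, hx, ENNReal.toReal_ofReal (Real.exp_pos _).le, Real.log_exp]
  have hid : Integrable (fun x : ℝ => x) (gaussianReal m₁ 1) :=
    memLp_one_iff_integrable.1 (memLp_id_gaussianReal 1)
  have hint : Integrable (fun x => (m₁ - m₂) * x - (m₁ ^ 2 - m₂ ^ 2) / 2) (gaussianReal m₁ 1) :=
    (hid.const_mul _).sub (integrable_const _)
  rw [InformationTheory.klDiv_of_ac_of_integrable hac ((integrable_congr hllr).2 hint),
    integral_congr_ae hllr, integral_sub (hid.const_mul _) (integrable_const _),
    integral_const_mul, integral_id_gaussianReal]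
  congr 1
  simp
  ring

end ProbabilityTheory

namespace CostSubsidyBandit

/-- The divergence grows as the alternative mean moves right of `mean ρ`, so the infimum is the
limit at `x`; it is not attained, the constraint being strict. -/
lemma Dinf_unitGaussians {ρ : ProbabilityMeasure ℝ} (hρ : ρ ∈ unitGaussians) {x : ℝ}
    (hx : mean ρ < x) :
    Dinf unitGaussians ρ x = ENNReal.ofReal ((x - mean ρ) ^ 2 / 2) := by
  obtain ⟨m, hm⟩ := hρ
  rw [mean_eq_of_eq_gaussianReal hm] at hx ⊢
  refine le_antisymm ?_ (le_iInf₂ fun ρ' hρ' => ?_)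
  · have hlim : Tendsto (fun y : ℝ => ENNReal.ofReal ((y - m) ^ 2 / 2)) (nhdsWithin x (Set.Ioi x))
        (nhds (ENNReal.ofReal ((x - m) ^ 2 / 2))) := by
      refine (ENNReal.continuous_ofReal.comp (by fun_prop : Continuous fun y : ℝ =>
        (y - m) ^ 2 / 2)).continuousWithinAt
    refine ge_of_tendsto hlim ?_
    filter_upwards [self_mem_nhdsWithin] with y hy
    let ρ' : ProbabilityMeasure ℝ := ⟨gaussianReal y 1, inferInstance⟩
    have hρ' : (ρ' : Measure ℝ) = gaussianReal y 1 := rfl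
    have hmem : ρ' ∈ unitGaussians ∧ x < mean ρ' :=
      ⟨⟨y, hρ'⟩, (mean_eq_of_eq_gaussianReal hρ').symm ▸ hy⟩
    refine (iInf₂_le ρ' hmem).trans ?_
    rw [hm, hρ', klDiv_gaussianReal_one, ← neg_sub y m, neg_sq]
  · obtain ⟨⟨y, hy⟩, hxy⟩ := hρ'
    rw [mean_eq_of_eq_gaussianReal hy] at hxy
    rw [hm, hy, klDiv_gaussianReal_one]
    refine ENNReal.ofReal_le_ofReal ?_
    nlinarith

end CostSubsidyBandit

theorem theorem1 {K : ℕ} (c : Fin K → ℝ) (α : ℝ) (hα0 : 0 ≤ α) (hα1 : α < 1)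
    (π : ℕ → CostSubsidyBandit.Policy K) :
    (∀ M : Set (ProbabilityMeasure ℝ),
      (∀ ρ ∈ M, Integrable (fun x : ℝ => x) (ρ : Measure ℝ)) →
      CostSubsidyBandit.IsConsistent M c α π →
      ∀ ν : CostSubsidyBandit.Instance K, (∀ i, ν i ∈ M) →
      ∀ a, CostSubsidyBandit.IsOptimalArm c α ν a →
      ∀ k, c k < c a →
        1 / CostSubsidyBandit.Dinf M (ν k) (CostSubsidyBandit.threshold α ν) ≤
          CostSubsidyBandit.liminfRate π ν k) ∧
    (∀ ν : CostSubsidyBandit.Instance K, (∀ i, ν i ∈ CostSubsidyBandit.unitGaussians) →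
      ∀ a, CostSubsidyBandit.IsOptimalArm c α ν a →
      ∀ k, c k < c a →
        1 / CostSubsidyBandit.Dinf CostSubsidyBandit.unitGaussians (ν k)
            (CostSubsidyBandit.threshold α ν) =
          ENNReal.ofReal
            (2 / (CostSubsidyBandit.threshold α ν - CostSubsidyBandit.mean (ν k)) ^ 2) ∧
        (CostSubsidyBandit.IsConsistent CostSubsidyBandit.unitGaussians c α π →
          ENNReal.ofReal
              (2 / (CostSubsidyBandit.threshold α ν - CostSubsidyBandit.mean (ν k)) ^ 2) ≤
            CostSubsidyBandit.liminfRate π ν k)) := by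
  have part1 := fun M (hcons : CostSubsidyBandit.IsConsistent M c α π)
      (ν : CostSubsidyBandit.Instance K) (hν : ∀ i, ν i ∈ M) a
      (ha : CostSubsidyBandit.IsOptimalArm c α ν a) k (hk : c k < c a) =>
    CostSubsidyBandit.one_div_Dinf_le_liminfRate hα0 hα1 hcons hν ha hk
  refine ⟨fun M _ => part1 M, fun ν hν a ha k hk => ?_⟩
  have hlt : CostSubsidyBandit.mean (ν k) < CostSubsidyBandit.threshold α ν :=
    not_le.1 fun h => absurd (ha.2 k h) (not_le.2 hk)
  have heq : 1 / CostSubsidyBandit.Dinf CostSubsidyBandit.unitGaussians (ν k)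
      (CostSubsidyBandit.threshold α ν) = ENNReal.ofReal
        (2 / (CostSubsidyBandit.threshold α ν - CostSubsidyBandit.mean (ν k)) ^ 2) := by
    have hpos : 0 < (CostSubsidyBandit.threshold α ν - CostSubsidyBandit.mean (ν k)) ^ 2 / 2 := by
      have := sub_pos.2 hlt
      positivity
    rw [CostSubsidyBandit.Dinf_unitGaussians (hν k) hlt, one_div,
      ← ENNReal.ofReal_inv_of_pos hpos, inv_div]
  exact ⟨heq, fun hcons => heq ▸ part1 _ hcons ν hν a ha k hk⟩
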